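/- Let $M$ be a smooth $n$-dimensional manifold and $D\subseteq TM\oplus T^*M$ a Dirac structure on $M$, i.e. a smooth subbundle that is maximal isotropic for $g((X,\alpha),(Y,\beta))=\frac12(\alpha(Y)+\beta(X))$ and whose smooth sections are closed under the Courant bracket $[(X,\alpha),(Y,\beta)]=([X,Y],\,i(X)d\beta-i(Y)d\alpha+\frac12 d(\beta(X)-\alpha(Y)))$. The tangent Dirac structure $D^{tg}\subseteq T(TM)\oplus T^*(TM)$ is spanned at each point by the values of the pairs $(X^C,\alpha^C)$ and $(X^V,\alpha^V)$, for all local smooth sections $(X,\alpha)$ of $D$, where, in local coordinates $x^i$ of $M$ and the induced coordinates $(x^i,v^i)$ of $TM$, for $X=\xi^i\frac{\partial}{\partial x^i}$ and $\alpha=\alpha_i\,dx^i$, $$X^C=\xi^i\frac{\partial}{\partial x^i}+v^i\frac{\partial \xi^j}{\partial x^i}\frac{\partial}{\partial v^j},\quad X^V=\xi^i\frac{\partial}{\partial v^i},\quad \alpha^C=v^j\frac{\partial\alpha_i}{\partial x^j}dx^i+\alpha_i\,dv^i,\quad \alpha^V=\alpha_i\,dx^i .$$ Let $N\subseteq M$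 be an embedded submanifold that is cosymplectic, i.e. the field of subspaces $$H_x(N,D)=\{Z\in T_xM : \exists\,\alpha\in \mathrm{ann}\,T_xN,\ (Z,\alpha)\in D_x\}\qquad (x\in N)$$ is a smooth normal bundle of $N$: it is a smooth vector bundle along $N$ and $T_xM=T_xN\oplus H_x(N,D)$ for all $x\in N$. Regard the total space $H=H(N,D)$ as a submanifold of $TM$, and for $p\in H$ let $$d(p)=\dim\bigl[D^{tg}_p\cap\bigl(T_pH\oplus \mathrm{ann}\,T_pH\bigr)\bigr]$$ be its cosymplecticity default in $(TM,D^{tg})$. Then $$\mathrm{codim}\,N\le d(p)\le \dim M=n$$ for every $p\in H(N,D)$ (in particular for $p$ in the zero section, which is identified with $N$). -/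

import Mathlib

open Set Module
open scoped Manifold ContDiff Topology

noncomputable section

namespace DiracGeometry

variable {E : Type*} [NormedAddCommGroup E] [NormedSpace ℝ E]
  {H : Type*} [TopologicalSpace H] (I : ModelWithCorners ℝ E H)
  {M : Type*} [TopologicalSpace M] [ChartedSpace H M]

/-! ### The bundle `T M ⊕ T* M` -/

/-- The cotangent space `T*_x M`. -/
abbrev Cotangent (x : M) : Type _ := TangentSpace I x →L[ℝ] ℝ

/-- The fibre `T_x M ⊕ T*_x M` of the big tangent bundle. -/
abbrev BigTangent (x : M) : Type _ := TangentSpace I x × Cotangent I x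

/-- The neutral metric `g((X, α), (Y, β)) = (α(Y) + β(X)) / 2`. -/
def metric {x : M} (a b : BigTangent I x) : ℝ := (a.2 b.1 + b.2 a.1) / 2

/-- A subspace of `T_x M ⊕ T*_x M` is isotropic if `g` vanishes on it. -/
def IsIsotropicSubspace {x : M} (L : Submodule ℝ (BigTangent I x)) : Prop :=
  ∀ a ∈ L, ∀ b ∈ L, metric I a b = 0

/-- The annihilator in `T*_x M` of a subspace of `T_x M`. -/
def ann {x : M} (W : Submodule ℝ (TangentSpace I x)) : Submodule ℝ (Cotangent I x) where
  carrier := {α | ∀ X ∈ W, α X = 0}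
  add_mem' := fun {α β} hα hβ X hX => by
    change α X + β X = 0
    rw [hα X hX, hβ X hX, add_zero]
  zero_mem' := fun _ _ => rfl
  smul_mem' := fun c α hα X hX => by
    change c • α X = 0
    rw [hα X hX, smul_zero]

/-! ### Smooth sections -/

section Sections

/-- The vector field `X` is smooth on `U`. -/
def SmoothFieldOn [IsManifold I 1 M] (X : Π x : M, TangentSpace I x) (U : Set M) : Prop :=
  ContMDiffOn I I.tangent ∞ (fun x => (⟨x, X x⟩ : TangentBundle I M)) U

/-- The differential `1`-form `α` is smooth on `U` (as a section of the cotangent bundle). -/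
def SmoothFormOn [IsManifold I 1 M] (α : Π x : M, Cotangent I x) (U : Set M) : Prop :=
  ContMDiffOn I (I.prod 𝓘(ℝ, E →L[ℝ] ℝ)) ∞
    (fun x => Bundle.TotalSpace.mk' (E →L[ℝ] ℝ)
      (E := fun x : M => TangentSpace I x →L[ℝ] Bundle.Trivial M ℝ x) x (α x)) U

/-- `(X, α)` is a smooth section over the open set `U` of the family of subspaces `D`. -/
structure IsLocalSection [IsManifold I 1 M] (D : Π x : M, Submodule ℝ (BigTangent I x))
    (U : Set M) (X : Π x : M, TangentSpace I x) (α : Π x : M, Cotangent I x) : Prop where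
  isOpen : IsOpen U
  smooth_field : SmoothFieldOn I X U
  smooth_form : SmoothFormOn I α U
  mem : ∀ x ∈ U, (X x, α x) ∈ D x

end Sections

/-! ### Coordinate expressions, exterior derivative and Courant bracket -/

/-- The vector field `X` read in the chart around `x₀`, i.e. its components `ξ^i` as functions of
the coordinates. -/
def fieldInChart (x₀ : M) (X : Π x : M, TangentSpace I x) : E → E :=
  VectorField.mpullbackWithin 𝓘(ℝ, E) I (extChartAt I x₀).symm X (range I)

/-- The `1`-form `α` read in the chart around `x₀` (its pull-back by the inverse of the chart),
i.e. its components `α_i` as functions of the coordinates. -/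
def formInChart (x₀ : M) (α : Π x : M, Cotangent I x) : E → (E →L[ℝ] ℝ) := fun y =>
  (α ((extChartAt I x₀).symm y)).comp
    (mfderivWithin 𝓘(ℝ, E) I (extChartAt I x₀).symm (range I) y)

/-- The derivative at `x` of the components of the vector field `X` in the chart around `x`:
`v ↦ (v^i ∂ξ^j/∂x^i)_j`. -/
def fieldDeriv (X : Π x : M, TangentSpace I x) (x : M) : E →L[ℝ] E :=
  fderivWithin ℝ (fieldInChart I x X) (range I) (extChartAt I x x)

/-- The derivative at `x` of the components of the `1`-form `α` in the chart around `x`: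
`v ↦ (v^j ∂α_i/∂x^j)_i`. -/
def formDeriv (α : Π x : M, Cotangent I x) (x : M) : E →L[ℝ] E →L[ℝ] ℝ :=
  fderivWithin ℝ (formInChart I x α) (range I) (extChartAt I x x)

/-- The contraction `i(v) dα` at `x` of the exterior derivative of the `1`-form `α`:
`dα(v, w) = v^i w^j (∂α_j/∂x^i - ∂α_i/∂x^j)`. The space `T_x M` is identified with `E` by the
chart around `x`. -/
def contractExtDeriv (α : Π x : M, Cotangent I x) (x : M) (v : TangentSpace I x) :
    Cotangent I x :=
  (formDeriv I α x v - (formDeriv I α x).flip v : E →L[ℝ] ℝ)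

/-- The differential at `x` of a real function. -/
def diff (f : M → ℝ) (x : M) : Cotangent I x := mfderiv I 𝓘(ℝ, ℝ) f x

/-- The Courant bracket
`[(X, α), (Y, β)] = ([X, Y], i(X)dβ - i(Y)dα + d(β(X) - α(Y)) / 2)` at the point `x`. -/
def courant (X : Π x : M, TangentSpace I x) (α : Π x : M, Cotangent I x)
    (Y : Π x : M, TangentSpace I x) (β : Π x : M, Cotangent I x) (x : M) : BigTangent I x :=
  (VectorField.mlieBracket I X Y x,
    contractExtDeriv I β x (X x) - contractExtDeriv I α x (Y x)
      + (1 / 2 : ℝ) • diff I (fun y => β y (X y) - α y (Y y)) x)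

/-! ### Dirac structures -/

/-- The family of subspaces `D x ⊆ T_x M ⊕ T*_x M` is a Dirac structure: a smooth subbundle which
is maximal isotropic and whose smooth sections are closed under the Courant bracket. -/
structure IsDirac [IsManifold I 1 M] (D : Π x : M, Submodule ℝ (BigTangent I x)) : Prop where
  smooth : ∀ x₀ : M, ∃ U : Set M, x₀ ∈ U ∧ ∃ (m : ℕ) (B : Fin m → Π x : M, TangentSpace I x)
    (ε : Fin m → Π x : M, Cotangent I x),
      (∀ i, IsLocalSection I D U (B i) (ε i)) ∧
      ∀ x ∈ U, LinearIndependent ℝ (fun i => (B i x, ε i x)) ∧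
        Submodule.span ℝ (range fun i => (B i x, ε i x)) = D x
  maximal_isotropic : ∀ x : M, Maximal (IsIsotropicSubspace I) (D x)
  involutive : ∀ (U : Set M) (X : Π x : M, TangentSpace I x) (α : Π x : M, Cotangent I x)
    (Y : Π x : M, TangentSpace I x) (β : Π x : M, Cotangent I x),
      IsLocalSection I D U X α → IsLocalSection I D U Y β →
      ∀ x ∈ U, courant I X α Y β x ∈ D x

/-! ### Submanifolds -/

/-- `N` is an embedded submanifold of dimension `k` of the manifold `M` without boundary: around
each of its points it is, in some chart of the maximal atlas, a `k`-dimensional affine slice. -/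
def IsEmbeddedSubmanifold (N : Set M) (k : ℕ) : Prop :=
  ∀ x ∈ N, ∃ e ∈ IsManifold.maximalAtlas I ∞ M, x ∈ e.source ∧
    ∃ W : Submodule ℝ E, finrank ℝ W = k ∧
      ∀ y ∈ e.source, (y ∈ N ↔ I (e y) - I (e x) ∈ W)

/-- The tangent space at `p` of the submanifold `N`, as a subspace of `T_p M`: it consists of the
velocities of the smooth curves through `p` which lie in `N`. (For an embedded submanifold these
velocities already form a subspace, so that taking the span adds nothing.) -/
def tangentOf (N : Set M) (p : M) : Submodule ℝ (TangentSpace I p) :=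
  Submodule.span ℝ {v : TangentSpace I p | ∃ (δ : ℝ) (c : ℝ → M), 0 < δ ∧
    ContMDiffOn 𝓘(ℝ, ℝ) I ∞ c (Ioo (-δ) δ) ∧ c 0 = p ∧ (∀ t ∈ Ioo (-δ) δ, c t ∈ N) ∧
    (mfderiv 𝓘(ℝ, ℝ) I c 0 (1 : ℝ) : E) = v}

/-- The pseudo-normal space
`H_x(N, D) = {Z ∈ T_x M | ∃ α ∈ ann T_x N, (Z, α) ∈ D_x}` of the submanifold `N`. -/
def pseudoNormal (D : Π x : M, Submodule ℝ (BigTangent I x)) (N : Set M) (x : M) :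
    Submodule ℝ (TangentSpace I x) :=
  Submodule.map (LinearMap.fst ℝ (TangentSpace I x) (Cotangent I x))
    (D x ⊓ Submodule.prod ⊤ (ann I (tangentOf I N x)))

/-- The submanifold `N` is cosymplectic: its pseudo-normal field is a differentiable normal bundle,
i.e. it is complementary to `T N` and locally spanned by linearly independent smooth vector
fields. -/
structure IsCosymplectic [IsManifold I 1 M] (D : Π x : M, Submodule ℝ (BigTangent I x))
    (N : Set M) : Prop where
  isCompl : ∀ x ∈ N, IsCompl (tangentOf I N x) (pseudoNormal I D N x)
  smooth : ∀ x₀ ∈ N, ∃ U : Set M, IsOpen U ∧ x₀ ∈ U ∧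
    ∃ (m : ℕ) (Z : Fin m → Π x : M, TangentSpace I x), (∀ i, SmoothFieldOn I (Z i) U) ∧
      ∀ x ∈ N ∩ U, LinearIndependent ℝ (fun i => Z i x) ∧
        Submodule.span ℝ (range fun i => Z i x) = pseudoNormal I D N x

/-- The cosymplecticity default `d(x) = dim (D_x ∩ (T_x N ⊕ ann T_x N))` of `N` in `(M, D)`. -/
def cosymplecticityDefault (D : Π x : M, Submodule ℝ (BigTangent I x)) (N : Set M) (x : M) : ℕ :=
  finrank ℝ ↥(D x ⊓ Submodule.prod (tangentOf I N x) (ann I (tangentOf I N x)))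

/-- The total space of the natural normal bundle `H(N, D)`, as a subset of `T M`. -/
def naturalNormalBundle (D : Π x : M, Submodule ℝ (BigTangent I x)) (N : Set M) :
    Set (TangentBundle I M) :=
  {p | p.proj ∈ N ∧ p.snd ∈ pseudoNormal I D N p.proj}

/-! ### Lifts to the tangent bundle and the tangent Dirac structure

The preferred chart of `T M` at `p = (x, v)` consists of the natural coordinates `(x^i, v^i)`
induced by the preferred chart of `M` at `x`; it identifies `T_p (T M)` with `E × E`, the first
factor carrying the components along `∂/∂x^i`, the second those along `∂/∂v^i`. -/

section Lifts

variable [IsManifold I 1 M]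

/-- The vertical lift `X^V = ξ^i ∂/∂v^i` of a vector field `X = ξ^i ∂/∂x^i`. -/
def verticalLift (X : Π x : M, TangentSpace I x) (p : TangentBundle I M) :
    TangentSpace I.tangent p :=
  ((0 : E), (X p.proj : E))

/-- The complete lift `X^C = ξ^i ∂/∂x^i + v^i (∂ξ^j/∂x^i) ∂/∂v^j` of a vector field
`X = ξ^i ∂/∂x^i`. -/
def completeLift (X : Π x : M, TangentSpace I x) (p : TangentBundle I M) :
    TangentSpace I.tangent p :=
  ((X p.proj : E), fieldDeriv I X p.proj p.snd)

/-- The vertical lift `α^V = α_i dx^i` (the pull-back to `T M`) of a `1`-form `α = α_i dx^i`. -/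
def verticalLiftForm (α : Π x : M, Cotangent I x) (p : TangentBundle I M) :
    Cotangent I.tangent p :=
  ((α p.proj : E →L[ℝ] ℝ).comp (ContinuousLinearMap.fst ℝ E E) : E × E →L[ℝ] ℝ)

/-- The complete lift `α^C = v^j (∂α_i/∂x^j) dx^i + α_i dv^i` of a `1`-form `α = α_i dx^i`. -/
def completeLiftForm (α : Π x : M, Cotangent I x) (p : TangentBundle I M) :
    Cotangent I.tangent p :=
  ((formDeriv I α p.proj p.snd : E →L[ℝ] ℝ).comp (ContinuousLinearMap.fst ℝ E E)
    + (α p.proj : E →L[ℝ] ℝ).comp (ContinuousLinearMap.snd ℝ E E) : E × E →L[ℝ] ℝ)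

/-- The tangent Dirac structure `D^tg` on `T M`: its fibre at `p` is spanned by the values at `p`
of the pairs `(X^C, α^C)` and `(X^V, α^V)`, where `(X, α)` runs over the smooth sections of `D`
near the base point of `p`. -/
def tangentDirac (D : Π x : M, Submodule ℝ (BigTangent I x)) (p : TangentBundle I M) :
    Submodule ℝ (BigTangent I.tangent p) :=
  Submodule.span ℝ {a | ∃ (U : Set M) (X : Π x : M, TangentSpace I x)
    (α : Π x : M, Cotangent I x), p.proj ∈ U ∧ IsLocalSection I D U X α ∧
      (a = (completeLift I X p, completeLiftForm I α p) ∨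
        a = (verticalLift I X p, verticalLiftForm I α p))}

end Lifts

end DiracGeometry

end

/-! Fix `p` over `x`, and let `S` be the space whose dimension is `d(p)`. The map `bigProj` sends
complete lifts `(X^C, α^C)` to `(X, α)` and kills vertical lifts. Its kernel is the image of the
injective map `bigVerticalLift`. Both bounds come from restricting these two maps to `S`.

Kernel: the vertical lifts in `S` are exactly those of `K = D_x ∩ (T_xM ⊕ ann T_xN)`
(`bigVerticalLift_mem_inf_prod_iff`). Since `D_x` is isotropic and `T_xM = T_xN ⊕ H_x`, projection
to vectors maps `K` isomorphically onto `H_x`, so `dim K = codim N`. This is the lower bound.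

Image: `bigProj` sends `S` into `D_x ∩ (T_xN ⊕ ann H_x)`, an isotropic space, hence of dimension at
most `dim T_xN`. Adding the kernel gives at most `n`.

The only delicate point is that a vertical lift in `D^tg` comes from `D`. Differentiating `α(Y) +
β(X) = 0` shows that `D^tg` is orthogonal to complete lifts. Against a vertical lift of `a`, this
says that `a` is orthogonal to `D_x`, and maximality gives `a ∈ D_x`. -/

namespace DiracGeometry

/-! ### Isotropic subspaces in a single fibre. -/

section LinearAlgebra

variable {E : Type*} [NormedAddCommGroup E] [NormedSpace ℝ E]
  {H : Type*} [TopologicalSpace H] {I : ModelWithCorners ℝ E H}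
  {M : Type*} [TopologicalSpace M] [ChartedSpace H M] {x : M}

theorem metric_eq_zero_iff (a b : BigTangent I x) : metric I a b = 0 ↔ a.2 b.1 + b.2 a.1 = 0 := by
  simp [metric]

/-- An isotropic vector orthogonal to a maximal isotropic subspace belongs to it. -/
theorem mem_of_isotropic_of_orthogonal {L : Submodule ℝ (BigTangent I x)}
    (hL : Maximal (IsIsotropicSubspace I) L) {a : BigTangent I x} (ha : a.2 a.1 = 0)
    (h : ∀ b ∈ L, a.2 b.1 + b.2 a.1 = 0) : a ∈ L := by
  have hiso : IsIsotropicSubspace I (L ⊔ Submodule.span ℝ {a}) := by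
    intro u hu v hv
    obtain ⟨b, hb, c, hc, rfl⟩ := Submodule.mem_sup.1 hu
    obtain ⟨b', hb', c', hc', rfl⟩ := Submodule.mem_sup.1 hv
    obtain ⟨s, rfl⟩ := Submodule.mem_span_singleton.1 hc
    obtain ⟨t, rfl⟩ := Submodule.mem_span_singleton.1 hc'
    rw [metric_eq_zero_iff]
    have h1 := (metric_eq_zero_iff b b').1 (hL.1 b hb b' hb')
    have h2 := h b hb
    have h3 := h b' hb'
    simp only [Prod.fst_add, Prod.snd_add, Prod.smul_fst, Prod.smul_snd, map_add, map_smul,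
      add_apply, smul_apply, smul_eq_mul, ha]
    linear_combination h1 + t * h2 + s * h3
  exact hL.2 hiso le_sup_left (Submodule.mem_sup_right (Submodule.mem_span_singleton_self a))

theorem ann_top : ann I (⊤ : Submodule ℝ (TangentSpace I x)) = ⊥ := by
  rw [eq_bot_iff]
  exact fun α hα => ContinuousLinearMap.ext fun X => hα X trivial

variable [FiniteDimensional ℝ E]

instance finiteDimensional_tangentSpace : FiniteDimensional ℝ (TangentSpace I x) :=
  inferInstanceAs (FiniteDimensional ℝ E)

instance finiteDimensional_cotangent : FiniteDimensional ℝ (Cotangent I x) :=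
  inferInstanceAs (FiniteDimensional ℝ (E →L[ℝ] ℝ))

/-- A vector on which all covectors annihilating `W` vanish belongs to `W`. -/
theorem mem_of_forall_mem_ann {W : Submodule ℝ (TangentSpace I x)} {Z : TangentSpace I x}
    (h : ∀ α ∈ ann I W, α Z = 0) : Z ∈ W := by
  by_contra hZ
  obtain ⟨f, hf, hle⟩ := Submodule.exists_le_ker_of_notMem hZ
  exact hf (h (LinearMap.toContinuousLinearMap (𝕜 := ℝ) (E := E) (F' := ℝ) f) fun X hX => hle hX)

/-- A maximal isotropic subspace contains its orthogonal space. -/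
theorem mem_of_orthogonal {L : Submodule ℝ (BigTangent I x)}
    (hL : Maximal (IsIsotropicSubspace I) L) {a : BigTangent I x}
    (h : ∀ b ∈ L, a.2 b.1 + b.2 a.1 = 0) : a ∈ L := by
  set A := Submodule.map (LinearMap.fst ℝ (TangentSpace I x) (Cotangent I x)) L with hA
  -- `a` itself is not known to be isotropic, so the previous lemma is applied to pure covectors
  -- only: first to `(0, α)`, which forces `a.1 ∈ A`, then to the difference of `a` and an element
  -- of `L` with the same vector part.
  have key : ∀ α ∈ ann I A, ((0, α) : BigTangent I x) ∈ L := fun α hα =>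
    mem_of_isotropic_of_orthogonal hL (map_zero α) fun b hb => by
      simpa using hα b.1 (Submodule.mem_map_of_mem hb)
  have hfst : a.1 ∈ A := mem_of_forall_mem_ann fun α hα => by
    simpa using h _ (key α hα)
  obtain ⟨b, hb, hba⟩ := hfst
  have hdiff : ((0, a.2 - b.2) : BigTangent I x) ∈ L := key _ fun X hX => by
    obtain ⟨c, hc, rfl⟩ := hX
    have h1 := h c hc
    have h2 := (metric_eq_zero_iff b c).1 (hL.1 b hb c hc)
    change b.1 = a.1 at hba
    rw [hba] at h2
    change a.2 c.1 - b.2 c.1 = 0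
    linarith
  have : a = b + (0, a.2 - b.2) := by
    change b.1 = a.1 at hba
    ext1 <;> simp [hba]
  rw [this]
  exact add_mem hb hdiff

/-- The annihilator of a subspace has at most complementary dimension. -/
theorem finrank_ann_add_le (W : Submodule ℝ (TangentSpace I x)) :
    finrank ℝ (ann I W) + finrank ℝ W ≤ finrank ℝ E := by
  have h1 : finrank ℝ (ann I W) ≤ finrank ℝ W.dualAnnihilator := by
    let f : ann I W →ₗ[ℝ] W.dualAnnihilator :=
      LinearMap.codRestrict _
        ((ContinuousLinearMap.coeLM ℝ : Cotangent I x →ₗ[ℝ] _).comp (ann I W).subtype)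
        fun α => (Submodule.mem_dualAnnihilator _).2 α.2
    refine LinearMap.finrank_le_finrank_of_injective (f := f) fun α β h => ?_
    have := congrArg Subtype.val h
    exact Subtype.ext (ContinuousLinearMap.coe_injective this)
  have h2 := Subspace.finrank_add_finrank_dualAnnihilator_eq W
  have h3 : finrank ℝ (TangentSpace I x) = finrank ℝ E := rfl
  omega

/-- If `L` projects into `B` and the covectors in `L` annihilate `W`, then
`dim L ≤ dim B + dim (ann W)`. -/
theorem finrank_le_of_fst_mem {L : Submodule ℝ (BigTangent I x)}
    {B W : Submodule ℝ (TangentSpace I x)}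
    (hB : ∀ a ∈ L, a.1 ∈ B) (hW : ∀ a ∈ L, a.1 = 0 → a.2 ∈ ann I W) :
    finrank ℝ L ≤ finrank ℝ B + finrank ℝ (ann I W) := by
  let f : L →ₗ[ℝ] B := LinearMap.codRestrict _
    ((LinearMap.fst ℝ (TangentSpace I x) (Cotangent I x)).comp L.subtype) fun a => hB a a.2
  have hker : ∀ a : LinearMap.ker f, (a : L).1.1 = 0 := fun a =>
    congrArg Subtype.val (LinearMap.mem_ker.1 a.2)
  let g : LinearMap.ker f →ₗ[ℝ] ann I W := LinearMap.codRestrict _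
    ((LinearMap.snd ℝ (TangentSpace I x) (Cotangent I x)).comp
      (L.subtype.comp (LinearMap.ker f).subtype)) fun a => hW _ a.1.2 (hker a)
  have hg : Function.Injective g := fun a b hab => by
    refine Subtype.ext (Subtype.ext (Prod.ext ?_ (congrArg Subtype.val hab)))
    rw [hker a, hker b]
  have h1 := LinearMap.finrank_range_add_finrank_ker (K := ℝ) (V := L) (V₂ := B) f
  have h2 := LinearMap.finrank_le_finrank_of_injective hg
  have h3 := Submodule.finrank_le (LinearMap.range f)
  omega

/-- An isotropic subspace of `T ⊕ ann C` has dimension at most `dim T`, if `T` and `C` are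
complementary. -/
theorem IsIsotropicSubspace.finrank_inf_prod_le {L : Submodule ℝ (BigTangent I x)}
    (hL : IsIsotropicSubspace I L) {T C : Submodule ℝ (TangentSpace I x)} (hTC : IsCompl T C) :
    finrank ℝ ↥(L ⊓ Submodule.prod T (ann I C)) ≤ finrank ℝ T := by
  set S := L ⊓ Submodule.prod T (ann I C) with hS
  set B := Submodule.map (LinearMap.fst ℝ (TangentSpace I x) (Cotangent I x)) S with hB
  have hBT : B ≤ T := by
    rintro _ ⟨a, ha, rfl⟩
    exact ha.2.1
  -- An element `(0, α)` of `S` has `α` vanishing on `C` by membership and on `B` by isotropy. As `B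
  -- ∩ C = 0`, the bound is `dim B + n - dim B - dim C = dim T`.
  have h1 : finrank ℝ S ≤ finrank ℝ B + finrank ℝ (ann I (B ⊔ C)) := by
    refine finrank_le_of_fst_mem (fun a ha => Submodule.mem_map_of_mem ha) fun a ha ha0 X hX => ?_
    obtain ⟨_, ⟨b, hb, rfl⟩, Z, hZ, rfl⟩ := Submodule.mem_sup.1 hX
    have h2 := (metric_eq_zero_iff a b).1 (hL a ha.1 b hb.1)
    rw [ha0, map_zero, add_zero] at h2
    rw [map_add, ha.2.2 Z hZ, add_zero]
    exact h2
  have h2 := finrank_ann_add_le (B ⊔ C)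
  have h3 := Submodule.finrank_sup_add_finrank_inf_eq B C
  have h4 : B ⊓ C = ⊥ := (hTC.disjoint.mono_left hBT).eq_bot
  rw [h4, finrank_bot] at h3
  have h5 := Submodule.finrank_add_eq_of_isCompl hTC
  have h6 : finrank ℝ (TangentSpace I x) = finrank ℝ E := rfl
  omega

/-- If `T` is complementary to `C = pr (L ∩ (T_x M ⊕ ann T))`, then `L ∩ (T_x M ⊕ ann T)` has the
dimension of `C`. -/
theorem IsIsotropicSubspace.finrank_inf_top_prod {L : Submodule ℝ (BigTangent I x)}
    (hL : IsIsotropicSubspace I L) {T C : Submodule ℝ (TangentSpace I x)} (hTC : IsCompl T C)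
    (hC : C = Submodule.map (LinearMap.fst ℝ (TangentSpace I x) (Cotangent I x))
      (L ⊓ Submodule.prod ⊤ (ann I T))) :
    finrank ℝ ↥(L ⊓ Submodule.prod ⊤ (ann I T)) = finrank ℝ C := by
  set K := L ⊓ Submodule.prod ⊤ (ann I T) with hK
  refine le_antisymm ?_ (hC ▸ Submodule.finrank_map_le _ _)
  -- An element `(0, α)` of `K` has `α` vanishing on `T` by membership and on `C` by isotropy, hence
  -- everywhere: the projection of `K` onto `C` is injective.
  have h1 : finrank ℝ K ≤ finrank ℝ C + finrank ℝ (ann I (⊤ : Submodule ℝ (TangentSpace I x))) := by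
    refine finrank_le_of_fst_mem (fun a ha => hC ▸ Submodule.mem_map_of_mem ha) ?_
    intro a ha ha0
    rw [← hTC.sup_eq_top]
    intro X hX
    obtain ⟨Y, hY, Z, hZ, rfl⟩ := Submodule.mem_sup.1 hX
    rw [hC] at hZ
    obtain ⟨b, hb, rfl⟩ := hZ
    have h2 := (metric_eq_zero_iff a b).1 (hL a ha.1 b hb.1)
    rw [ha0, map_zero, add_zero] at h2
    rw [map_add, ha.2.2 Y hY, zero_add]
    exact h2
  rwa [ann_top, finrank_bot, add_zero] at h1

end LinearAlgebra

/-! ### Velocities of curves in `M` and `TM`. -/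

section Curves

variable {E : Type*} [NormedAddCommGroup E] [NormedSpace ℝ E]
  {H : Type*} [TopologicalSpace H] {I : ModelWithCorners ℝ E H}
  {M : Type*} [TopologicalSpace M] [ChartedSpace H M]

/-- The velocity of a curve is the derivative of its expression in the preferred chart. -/
theorem hasDerivAt_extChartAt_comp {c : ℝ → M} (hc : MDifferentiableAt 𝓘(ℝ, ℝ) I c 0) :
    HasDerivAt (fun t => extChartAt I (c 0) (c t)) (mfderiv 𝓘(ℝ, ℝ) I c 0 (1 : ℝ) : E) 0 := by
  have h := hc.hasMFDerivAt.2
  simp only [mfld_simps, writtenInExtChartAt] at h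
  let L : ℝ →L[ℝ] E := mfderiv 𝓘(ℝ, ℝ) I c 0
  have h' : HasFDerivAt (fun t => (extChartAt I (c 0) (c t) : E)) L 0 := hasFDerivWithinAt_univ.1 h
  change HasDerivAt (fun t => (extChartAt I (c 0) (c t) : E)) (L 1) 0
  exact h'.hasDerivAt

theorem mfderiv_curve_eq {c : ℝ → M} (hc : MDifferentiableAt 𝓘(ℝ, ℝ) I c 0) {v : E}
    (h : HasDerivAt (fun t => extChartAt I (c 0) (c t)) v 0) :
    (mfderiv 𝓘(ℝ, ℝ) I c 0 (1 : ℝ) : E) = v :=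
  (hasDerivAt_extChartAt_comp hc).unique h

variable [IsManifold I 1 M]

theorem extChartAt_tangentBundle_fst (p q : TangentBundle I M) :
    (extChartAt I.tangent p q).1 = extChartAt I p.proj q.proj := rfl

/-- The chart at `p` comes from the trivialization at `p.proj`, whose coordinate change over its own
base point is the identity. -/
theorem extChartAt_tangentBundle_snd (p : TangentBundle I M) (w : TangentSpace I p.proj) :
    (extChartAt I.tangent p ⟨p.proj, w⟩).2 = w := by
  have h := (tangentBundleCore I M).coordChange_self (achart H p.proj) p.proj
    (mem_chart_source H p.proj) w
  exact h

/-- The base component of the velocity of a curve in the tangent bundle is the velocity of the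
projected curve. -/
theorem mfderiv_curve_proj {c : ℝ → TangentBundle I M}
    (hc : MDifferentiableAt 𝓘(ℝ, ℝ) I.tangent c 0)
    (hc' : MDifferentiableAt 𝓘(ℝ, ℝ) I (fun t => (c t).proj) 0) :
    (mfderiv 𝓘(ℝ, ℝ) I (fun t => (c t).proj) 0 (1 : ℝ) : E) =
      (mfderiv 𝓘(ℝ, ℝ) I.tangent c 0 (1 : ℝ) : E × E).1 :=
  mfderiv_curve_eq hc' (hasDerivAt_extChartAt_comp hc).fst

end Curves

/-! ### Tangent spaces of `N` and of `H(N, D)`. -/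

section TangentSpaces

variable {E : Type*} [NormedAddCommGroup E] [NormedSpace ℝ E]
  {H : Type*} [TopologicalSpace H] {I : ModelWithCorners ℝ E H}
  {M : Type*} [TopologicalSpace M] [ChartedSpace H M]
  {D : Π x : M, Submodule ℝ (BigTangent I x)} {N : Set M}

theorem mdifferentiableAt_of_contMDiffOn_Ioo {E' : Type*} [NormedAddCommGroup E']
    [NormedSpace ℝ E'] {H' : Type*} [TopologicalSpace H'] {J : ModelWithCorners ℝ E' H'}
    {M' : Type*} [TopologicalSpace M'] [ChartedSpace H' M'] {δ : ℝ} (hδ : 0 < δ) {c : ℝ → M'}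
    (hc : ContMDiffOn 𝓘(ℝ, ℝ) J ∞ c (Ioo (-δ) δ)) : MDifferentiableAt 𝓘(ℝ, ℝ) J c 0 :=
  ((hc 0 ⟨by linarith, hδ⟩).contMDiffAt (Ioo_mem_nhds (by linarith) hδ)).mdifferentiableAt (by simp)

/-- The tangent spaces of a `k`-dimensional embedded submanifold have dimension at most `k`. -/
theorem IsEmbeddedSubmanifold.finrank_tangentOf_le [FiniteDimensional ℝ E] {k : ℕ}
    (hN : IsEmbeddedSubmanifold I N k) {x : M} (hx : x ∈ N) : finrank ℝ (tangentOf I N x) ≤ k := by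
  obtain ⟨e, he, hxe, W, rfl, hW⟩ := hN x hx
  have hediff : MDifferentiableAt I I e x :=
    ((contMDiffOn_of_mem_maximalAtlas he).contMDiffAt (e.open_source.mem_nhds hxe)).mdifferentiableAt
      (by simp)
  have hesymm : MDifferentiableAt I I e.symm (e x) :=
    ((contMDiffOn_symm_of_mem_maximalAtlas he).contMDiffAt
      (e.open_target.mem_nhds (e.map_source hxe))).mdifferentiableAt (by simp)
  let g : TangentSpace I x →ₗ[ℝ] E := (mfderiv I I e x : E →L[ℝ] E).toLinearMap
  have hg : Function.Injective g := by
    have h1 : (mfderiv I I e.symm (e x)).comp (mfderiv I I e x) = ContinuousLinearMap.id ℝ _ := by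
      rw [← mfderiv_comp x hesymm hediff, ← mfderiv_id]
      refine Filter.EventuallyEq.mfderiv_eq ?_
      filter_upwards [e.open_source.mem_nhds hxe] with y hy using e.left_inv hy
    intro v w hvw
    have h2 : ∀ v, mfderiv I I e.symm (e x) (mfderiv I I e x v) = v := fun v =>
      congrArg (fun f : E →L[ℝ] E => f v) h1
    rw [← h2 v, ← h2 w]
    exact congrArg _ hvw
  have hle : tangentOf I N x ≤ W.comap g := by
    refine Submodule.span_le.2 ?_
    rintro _ ⟨δ, c, hδ, hc, rfl, hcN, rfl⟩
    have hcd := mdifferentiableAt_of_contMDiffOn_Ioo hδ hc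
    have h1 : (mfderiv 𝓘(ℝ, ℝ) I (e ∘ c) 0 (1 : ℝ) : E) =
        g (mfderiv 𝓘(ℝ, ℝ) I c 0 (1 : ℝ)) :=
      congrArg (fun f : ℝ →L[ℝ] E => f 1) (mfderiv_comp 0 hediff hcd)
    change g (mfderiv 𝓘(ℝ, ℝ) I c 0 (1 : ℝ)) ∈ W
    rw [← h1]
    -- The velocity is a limit of difference quotients, which lie in the closed subspace `W` because
    -- the curve stays in the slice.
    have h2 := hasDerivAt_iff_tendsto_slope.1 (hasDerivAt_extChartAt_comp (hediff.comp 0 hcd))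
    refine W.closed_of_finiteDimensional.mem_of_tendsto h2 ?_
    refine nhdsWithin_le_nhds ?_
    filter_upwards [hcd.continuousAt.preimage_mem_nhds (e.open_source.mem_nhds hxe),
      Ioo_mem_nhds (neg_lt_zero.2 hδ) hδ] with t ht ht'
    refine W.smul_mem _ ?_
    have h3 := (hW (c t) ht).1 (hcN t ht')
    exact h3
  have h1 := Submodule.finrank_mono hle
  have h2 : finrank ℝ (W.comap g) ≤ finrank ℝ W := by
    refine LinearMap.finrank_le_finrank_of_injective
      (f := (g.restrict fun a ha => ha : W.comap g →ₗ[ℝ] W)) ?_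
    intro a b hab
    exact Subtype.ext (hg (congrArg Subtype.val hab))
  exact h1.trans h2

variable [IsManifold I ∞ M]

/-- The tangent spaces of `H(N, D)` project into those of `N`. -/
theorem fst_mem_tangentOf {p : TangentBundle I M} {X : TangentSpace I.tangent p}
    (hX : X ∈ tangentOf I.tangent (naturalNormalBundle I D N) p) :
    ((X : E × E).1 : TangentSpace I p.proj) ∈ tangentOf I N p.proj := by
  let f : TangentSpace I.tangent p →ₗ[ℝ] TangentSpace I p.proj := LinearMap.fst ℝ E E
  suffices h : tangentOf I.tangent (naturalNormalBundle I D N) p ≤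
      (tangentOf I N p.proj).comap f from h hX
  refine Submodule.span_le.2 ?_
  rintro _ ⟨δ, c, hδ, hc, rfl, hcN, rfl⟩
  have hc' : ContMDiffOn 𝓘(ℝ, ℝ) I ∞ (fun t => (c t).proj) (Ioo (-δ) δ) :=
    (Bundle.contMDiff_proj (TangentSpace I : M → Type _)).comp_contMDiffOn hc
  refine Submodule.subset_span ⟨δ, fun t => (c t).proj, hδ, hc', rfl, fun t ht => (hcN t ht).1, ?_⟩
  exact mfderiv_curve_proj (mdifferentiableAt_of_contMDiffOn_Ioo hδ hc)
    (mdifferentiableAt_of_contMDiffOn_Ioo hδ hc')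

/-- The vertical lifts of the vectors of `H(N, D)` are tangent to `H(N, D)`. -/
theorem vertical_mem_tangentOf {p : TangentBundle I M} (hp : p ∈ naturalNormalBundle I D N)
    {Z : TangentSpace I p.proj} (hZ : Z ∈ pseudoNormal I D N p.proj) :
    (((0 : E), (Z : E)) : TangentSpace I.tangent p) ∈
      tangentOf I.tangent (naturalNormalBundle I D N) p := by
  obtain ⟨x, v⟩ := p
  let v' : E := v
  let Z' : E := Z
  let c : ℝ → TangentBundle I M := fun t => ⟨x, v + t • Z⟩
  have hsnd : ∀ t, (extChartAt I.tangent (⟨x, v⟩ : TangentBundle I M) (c t)).2 =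
    v' + t • Z' := fun t => extChartAt_tangentBundle_snd (⟨x, v⟩ : TangentBundle I M) _
  have hlin : ContDiff ℝ ∞ (fun t : ℝ => v' + t • Z') :=
    contDiff_const.add (contDiff_id.smul contDiff_const)
  have hc : ContMDiff 𝓘(ℝ, ℝ) I.tangent ∞ c := fun t => by
    refine Bundle.contMDiffAt_totalSpace.2 ⟨contMDiffAt_const, ?_⟩
    exact (hlin.contMDiff (x := t)).congr_of_eventuallyEq (Filter.Eventually.of_forall hsnd)
  have hc0 : c 0 = ⟨x, v⟩ := by simp [c]
  refine Submodule.subset_span ⟨1, c, one_pos, hc.contMDiffOn, hc0, fun t _ => ⟨hp.1, ?_⟩, ?_⟩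
  · exact add_mem hp.2 (Submodule.smul_mem _ t hZ)
  · refine mfderiv_curve_eq (hc.mdifferentiableAt (by simp)) ?_
    rw [hc0]
    have h2 : HasDerivAt (fun t : ℝ => v' + t • Z') Z' 0 := by
      have := ((hasDerivAt_id (0 : ℝ)).smul_const Z').const_add v'
      simpa using this
    refine HasDerivAt.prodMk
      (f₁ := fun t => (extChartAt I.tangent (⟨x, v⟩ : TangentBundle I M) (c t)).1)
      (f₂ := fun t => (extChartAt I.tangent (⟨x, v⟩ : TangentBundle I M) (c t)).2) ?_ ?_
    · exact hasDerivAt_const (0 : ℝ) (extChartAt I x x)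
    · exact h2.congr_of_eventuallyEq (Filter.Eventually.of_forall hsnd)

/-- Every vector tangent to `N` is the projection of a vector tangent to `H(N, D)`. -/
theorem exists_mem_tangentOf_fst_eq (hcos : IsCosymplectic I D N) {p : TangentBundle I M}
    (hp : p ∈ naturalNormalBundle I D N) {v : TangentSpace I p.proj}
    (hv : v ∈ tangentOf I N p.proj) :
    ∃ w ∈ tangentOf I.tangent (naturalNormalBundle I D N) p, (w : E × E).1 = v := by
  let f : TangentSpace I.tangent p →ₗ[ℝ] TangentSpace I p.proj := LinearMap.fst ℝ E E
  suffices h : tangentOf I N p.proj ≤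
      (tangentOf I.tangent (naturalNormalBundle I D N) p).map f from h hv
  refine Submodule.span_le.2 ?_
  obtain ⟨x, u⟩ := p
  rintro _ ⟨δ, c, hδ, hc, hc0, hcN, rfl⟩
  change c 0 = x at hc0
  subst hc0
  obtain ⟨U, hU, hxU, m, Z, hZ, hspan⟩ := hcos.smooth (c 0) hp.1
  -- The vector `u` extends to the section `∑ a i • Z i` with constant coefficients; evaluated along
  -- `c`, it lifts `c` to a curve in `H(N, D)` through the given point. The frame exists only on
  -- `U`, so the time interval is shortened.
  obtain ⟨a, ha⟩ := (Submodule.mem_span_range_iff_exists_fun ℝ).1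
    ((hspan (c 0) ⟨hp.1, hxU⟩).2.symm ▸ hp.2 : u ∈ Submodule.span ℝ (range fun i => Z i (c 0)))
  have hY : SmoothFieldOn I (fun x => ∑ i, a i • Z i x) U :=
    ContMDiffOn.sum_section fun i _ => ContMDiffOn.const_smul_section (hZ i)
  have hcont : ContinuousAt c 0 :=
    (mdifferentiableAt_of_contMDiffOn_Ioo hδ hc).continuousAt
  obtain ⟨ε, hε, hεU⟩ := Metric.mem_nhds_iff.1 (hcont.preimage_mem_nhds (hU.mem_nhds hxU))
  rw [Real.ball_eq_Ioo, zero_sub, zero_add] at hεU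
  have hr : 0 < min δ ε := lt_min hδ hε
  have hsub : Ioo (-min δ ε) (min δ ε) ⊆ Ioo (-δ) δ :=
    Ioo_subset_Ioo (neg_le_neg (min_le_left _ _)) (min_le_left _ _)
  have hsub' : Ioo (-min δ ε) (min δ ε) ⊆ c ⁻¹' U :=
    (Ioo_subset_Ioo (neg_le_neg (min_le_right _ _)) (min_le_right _ _)).trans hεU
  let b : ℝ → TangentBundle I M := fun t => ⟨c t, ∑ i, a i • Z i (c t)⟩
  have hb : ContMDiffOn 𝓘(ℝ, ℝ) I.tangent ∞ b (Ioo (-min δ ε) (min δ ε)) :=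
    hY.comp (hc.mono hsub) hsub'
  have hb0 : b 0 = ⟨c 0, u⟩ := by
    change (⟨c 0, ∑ i, a i • Z i (c 0)⟩ : TangentBundle I M) = _
    rw [ha]
  refine ⟨(mfderiv 𝓘(ℝ, ℝ) I.tangent b 0 (1 : ℝ) : E × E), Submodule.subset_span
    ⟨min δ ε, b, hr, hb, hb0, fun t ht => ⟨hcN t (hsub ht), ?_⟩, rfl⟩, ?_⟩
  · change (∑ i, a i • Z i (c t)) ∈ pseudoNormal I D N (c t)
    rw [← (hspan (c t) ⟨hcN t (hsub ht), hsub' ht⟩).2]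
    exact Submodule.sum_mem _ fun i _ => Submodule.smul_mem _ _ (Submodule.subset_span ⟨i, rfl⟩)
  · exact (mfderiv_curve_proj (mdifferentiableAt_of_contMDiffOn_Ioo hr hb)
      (mdifferentiableAt_of_contMDiffOn_Ioo hδ hc)).symm

end TangentSpaces

/-! ### The tangent Dirac structure, its projection and its vertical lifts. -/

section TangentDirac

variable {E : Type*} [NormedAddCommGroup E] [NormedSpace ℝ E]
  {H : Type*} [TopologicalSpace H] {I : ModelWithCorners ℝ E H}
  {M : Type*} [TopologicalSpace M] [ChartedSpace H M] [IsManifold I ∞ M]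
  {D : Π x : M, Submodule ℝ (BigTangent I x)}

theorem fieldInChart_self (X : Π x : M, TangentSpace I x) (x : M) :
    fieldInChart I x X (extChartAt I x x) = (X x : E) := by
  have h := mfderivWithin_extChartAt_symm_inverse_apply (I := I) (x := x)
    (X ((extChartAt I x).symm (extChartAt I x x)))
  refine Eq.trans h ?_
  rw [extChartAt_to_inv]

theorem formInChart_self (α : Π x : M, Cotangent I x) (x : M) :
    formInChart I x α (extChartAt I x x) = (α x : E →L[ℝ] ℝ) := by
  unfold formInChart
  rw [mfderivWithin_range_extChartAt_symm]
  have h : ∀ z : M, z = x → (α z : E →L[ℝ] ℝ) = α x := by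
    rintro _ rfl
    rfl
  exact h _ (extChartAt_to_inv x)

/-- The pairing of a `1`-form and a vector field may be computed in a chart. -/
theorem formInChart_fieldInChart (α : Π x : M, Cotangent I x) (X : Π x : M, TangentSpace I x)
    (x : M) {y : E} (hy : y ∈ (extChartAt I x).target) :
    formInChart I x α y (fieldInChart I x X y) =
      α ((extChartAt I x).symm y) (X ((extChartAt I x).symm y)) :=
  congrArg (α ((extChartAt I x).symm y))
    ((isInvertible_mfderivWithin_extChartAt_symm hy).self_apply_inverse _)

/-- Ensures that `fieldDeriv` is a true derivative rather than the default value of `fderivWithin`,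
as the product rule requires. -/
theorem SmoothFieldOn.hasFDerivWithinAt_fieldInChart [CompleteSpace E]
    {X : Π x : M, TangentSpace I x} {U : Set M} (hX : SmoothFieldOn I X U) (hU : IsOpen U) {x : M}
    (hx : x ∈ U) :
    HasFDerivWithinAt (fieldInChart I x X) (fieldDeriv I X x) (range I) (extChartAt I x x) := by
  have h1 : ContMDiffWithinAt I I.tangent 1 (fun x => (⟨x, X x⟩ : TangentBundle I M)) univ x :=
    (((hX x hx).contMDiffAt (hU.mem_nhds hx)).of_le (by simp)).contMDiffWithinAt
  -- Pulling back uses the derivative of the chart, which costs one order: hence `n := 2` for a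
  -- field of class `C^1`.
  have h2 := VectorField.contMDiffWithinAt_mpullbackWithin_extChartAt_symm (n := 2) h1
    uniqueMDiffOn_univ trivial (by norm_num)
  rw [preimage_univ, inter_univ] at h2
  have h3 := (contMDiffWithinAt_vectorSpace_iff_contDiffWithinAt.1 h2).mono_of_mem_nhdsWithin
    (extChartAt_target_mem_nhdsWithin x)
  exact (h3.differentiableWithinAt one_ne_zero).hasFDerivWithinAt

theorem SmoothFormOn.hasFDerivWithinAt_formInChart
    {α : Π x : M, Cotangent I x} {U : Set M} (hα : SmoothFormOn I α U) (hU : IsOpen U) {x : M}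
    (hx : x ∈ U) :
    HasFDerivWithinAt (formInChart I x α) (formDeriv I α x) (range I) (extChartAt I x x) := by
  have h1 := ((contMDiffAt_hom_bundle _).1 ((hα x hx).contMDiffAt (hU.mem_nhds hx))).2
  have h2 := ContMDiffAt.comp_contMDiffWithinAt_of_eq h1
    (contMDiffWithinAt_extChartAt_symm_range_self (n := ∞) x) (extChartAt_to_inv x)
  -- On the chart target the hom-bundle coordinates of `α` coincide with `formInChart`.
  have h3 : ContDiffWithinAt ℝ ∞ (formInChart I x α) (range I) (extChartAt I x x) := by
    refine h2.contDiffWithinAt.congr_of_eventuallyEq_of_mem ?_ (mem_range_self _)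
    filter_upwards [extChartAt_target_mem_nhdsWithin x] with y hy
    have hs := (extChartAt I x).map_target hy
    rw [extChartAt_source] at hs
    simp only [Function.comp, ContinuousLinearMap.inCoordinates]
    rw [TangentBundle.symmL_trivializationAt hs, (extChartAt I x).right_inv hy]
    refine ContinuousLinearMap.ext fun v => ?_
    exact (congrArg (fun f : ℝ →L[ℝ] ℝ => f _)
      (Bundle.Trivial.continuousLinearMapAt_trivialization ℝ M ℝ
        ((extChartAt I x).symm y))).symm
  exact (h3.differentiableWithinAt (by simp)).hasFDerivWithinAt

/-- The derivative of the pairing of a `1`-form and a vector field. -/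
theorem hasFDerivWithinAt_pairing [CompleteSpace E] {U : Set M} {X : Π x : M, TangentSpace I x}
    {α : Π x : M, Cotangent I x} (hX : SmoothFieldOn I X U) (hα : SmoothFormOn I α U)
    (hU : IsOpen U) {x : M} (hx : x ∈ U) :
    HasFDerivWithinAt (fun y => formInChart I x α y (fieldInChart I x X y))
      ((formInChart I x α (extChartAt I x x)).comp (fieldDeriv I X x) +
        (formDeriv I α x).flip (fieldInChart I x X (extChartAt I x x)))
      (range I) (extChartAt I x x) :=
  (hα.hasFDerivWithinAt_formInChart hU hx).clm_apply (hX.hasFDerivWithinAt_fieldInChart hU hx)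

theorem IsLocalSection.mono {U V : Set M} {X : Π x : M, TangentSpace I x}
    {α : Π x : M, Cotangent I x} (h : IsLocalSection I D U X α) (hV : IsOpen V) (hVU : V ⊆ U) :
    IsLocalSection I D V X α :=
  ⟨hV, h.smooth_field.mono hVU, h.smooth_form.mono hVU, fun x hx => h.mem x (hVU hx)⟩

/-- The complete lifts of two sections of an isotropic family are orthogonal. -/
theorem completeLift_orthogonal [CompleteSpace E] (hD : ∀ x, IsIsotropicSubspace I (D x))
    {U V : Set M} {X Y : Π x : M, TangentSpace I x} {α β : Π x : M, Cotangent I x}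
    (hX : IsLocalSection I D U X α) (hY : IsLocalSection I D V Y β) {p : TangentBundle I M}
    (hU : p.proj ∈ U) (hV : p.proj ∈ V) :
    completeLiftForm I α p (completeLift I Y p) + completeLiftForm I β p (completeLift I X p) =
      0 := by
  have hUV := hX.isOpen.inter hY.isOpen
  have hx : p.proj ∈ U ∩ V := ⟨hU, hV⟩
  obtain ⟨-, hX1, hX2, hX3⟩ := hX.mono hUV inter_subset_left
  obtain ⟨-, hY1, hY2, hY3⟩ := hY.mono hUV inter_subset_right
  -- By the product rule, the derivative of `α(Y) + β(X)` in the direction `p.snd` is exactly the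
  -- pairing of the complete lifts. The function vanishes near the base point by isotropy.
  have h1 := (hasFDerivWithinAt_pairing hY1 hX2 hUV hx).add
    (hasFDerivWithinAt_pairing hX1 hY2 hUV hx)
  have h0 : (fun y => formInChart I p.proj α y (fieldInChart I p.proj Y y)) +
      (fun y => formInChart I p.proj β y (fieldInChart I p.proj X y))
      =ᶠ[𝓝[range I] (extChartAt I p.proj p.proj)] fun _ => 0 := by
    filter_upwards [extChartAt_target_mem_nhdsWithin p.proj,
      (contMDiffWithinAt_extChartAt_symm_range_self (I := I) (n := ∞)
        p.proj).continuousWithinAt.preimage_mem_nhdsWithin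
        (by rw [extChartAt_to_inv]; exact hUV.mem_nhds hx)] with y hy hyU
    simp only [Pi.add_apply]
    rw [formInChart_fieldInChart α Y _ hy, formInChart_fieldInChart β X _ hy]
    exact (metric_eq_zero_iff _ _).1 (hD _ _ (hX3 _ hyU) _ (hY3 _ hyU))
  have h2 := HasFDerivWithinAt.congr_of_eventuallyEq h1 h0.symm
    (h0.symm.eq_of_nhdsWithin (mem_range_self _))
  have h3 := (I.uniqueDiffOn _ (mem_range_self _)).eq h2 (hasFDerivWithinAt_const (0 : ℝ) _ _)
  have h4 := congrArg (fun f : E →L[ℝ] ℝ => f p.snd) h3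
  simp only [fieldInChart_self, formInChart_self] at h4
  have h5 : (α p.proj (fieldDeriv I Y p.proj p.snd) + formDeriv I α p.proj p.snd (Y p.proj)) +
    (β p.proj (fieldDeriv I X p.proj p.snd) + formDeriv I β p.proj p.snd (X p.proj)) = 0 := h4
  change (formDeriv I α p.proj p.snd (Y p.proj) + α p.proj (fieldDeriv I Y p.proj p.snd)) +
    (formDeriv I β p.proj p.snd (X p.proj) + β p.proj (fieldDeriv I X p.proj p.snd)) = 0
  linarith

/-- Every element of a Dirac structure is the value of a local section. -/
theorem IsDirac.exists_isLocalSection (hD : IsDirac I D) {x : M} {a : BigTangent I x}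
    (ha : a ∈ D x) : ∃ (U : Set M) (X : Π x : M, TangentSpace I x) (α : Π x : M, Cotangent I x),
      x ∈ U ∧ IsLocalSection I D U X α ∧ (X x, α x) = a := by
  obtain ⟨U, hxU, m, B, ε, hB, hspan⟩ := hD.smooth x
  obtain ⟨V, hV, hxV, hBV⟩ : ∃ V : Set M, IsOpen V ∧ x ∈ V ∧
      ∀ i, IsLocalSection I D V (B i) (ε i) := by
    -- `U` is known to be open only through a member of the frame; for an empty frame any open set
    -- will do.
    cases m with
    | zero => exact ⟨univ, isOpen_univ, trivial, fun i => i.elim0⟩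
    | succ m => exact ⟨U, (hB 0).isOpen, hxU, hB⟩
  obtain ⟨c, hc⟩ := (Submodule.mem_span_range_iff_exists_fun ℝ).1 ((hspan x hxU).2.symm ▸ ha)
  have hpair : ∀ y, ((∑ i, c i • B i y, ∑ i, c i • ε i y) : BigTangent I y) =
      ∑ i, c i • (B i y, ε i y) := fun y => by
    simp only [Prod.smul_mk, Prod.ext_iff, Prod.fst_sum, Prod.snd_sum, and_self]
  refine ⟨V, fun y => ∑ i, c i • B i y, fun y => ∑ i, c i • ε i y, hxV, ⟨hV, ?_, ?_, ?_⟩, ?_⟩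
  · exact ContMDiffOn.sum_section fun i _ =>
      ContMDiffOn.const_smul_section (hBV i).smooth_field
  · exact ContMDiffOn.sum_section (V := fun x : M => TangentSpace I x →L[ℝ] Bundle.Trivial M ℝ x)
      fun i _ => ContMDiffOn.const_smul_section (hBV i).smooth_form
  · intro y hy
    rw [hpair]
    exact Submodule.sum_mem _ fun i _ => Submodule.smul_mem _ _ ((hBV i).mem y hy)
  · rw [hpair]
    exact hc

/-- The tangent Dirac structure is orthogonal to the complete lifts of the sections. -/
theorem tangentDirac_orthogonal_completeLift [CompleteSpace E]
    (hD : ∀ x, IsIsotropicSubspace I (D x)) {V : Set M} {Y : Π x : M, TangentSpace I x}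
    {β : Π x : M, Cotangent I x} (hY : IsLocalSection I D V Y β) {p : TangentBundle I M}
    (hV : p.proj ∈ V) {a : BigTangent I.tangent p} (ha : a ∈ tangentDirac I D p) :
    a.2 (completeLift I Y p) + completeLiftForm I β p a.1 = 0 := by
  induction ha using Submodule.span_induction with
  | mem a ha =>
    obtain ⟨U, X, α, hU, hX, rfl | rfl⟩ := ha
    · exact completeLift_orthogonal hD hX hY hU hV
    -- Against a vertical lift the derivative terms drop out, leaving the pairing of the two
    -- sections in `D`.
    · have h := (metric_eq_zero_iff _ _).1 (hD _ _ (hX.mem _ hU) _ (hY.mem _ hV))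
      change α p.proj (Y p.proj) + (formDeriv I β p.proj p.snd 0 + β p.proj (X p.proj)) = 0
      rw [map_zero, zero_add]
      exact h
  | zero => simp
  | add a b _ _ ha hb =>
    simp only [Prod.fst_add, Prod.snd_add, map_add, add_apply]
    linear_combination ha + hb
  | smul c a _ ha =>
    simp only [Prod.smul_fst, Prod.smul_snd, map_smul, smul_apply, smul_eq_mul]
    linear_combination c * ha

/-- The projection `T_p(TM) ⊕ T*_p(TM) → T_x M ⊕ T*_x M` which sends `(X^C, α^C)` to `(X, α)` and
`(X^V, α^V)` to zero. -/
noncomputable def bigProj (p : TangentBundle I M) :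
    BigTangent I.tangent p →ₗ[ℝ] BigTangent I p.proj where
  toFun a := ((a.1 : E × E).1, (a.2 : E × E →L[ℝ] ℝ).comp (ContinuousLinearMap.inr ℝ E E))
  map_add' _ _ := rfl
  map_smul' _ _ := rfl

/-- The linear map `T_x M ⊕ T*_x M → T_p(TM) ⊕ T*_p(TM)` which sends `(X, α)` to `(X^V, α^V)`. -/
noncomputable def bigVerticalLift (p : TangentBundle I M) :
    BigTangent I p.proj →ₗ[ℝ] BigTangent I.tangent p where
  toFun a := (((0 : E), (a.1 : E)), (a.2 : E →L[ℝ] ℝ).comp (ContinuousLinearMap.fst ℝ E E))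
  map_add' _ _ := Prod.ext (Prod.ext (add_zero (0 : E)).symm rfl) rfl
  map_smul' c _ := Prod.ext (Prod.ext (smul_zero (A := E) c).symm rfl) rfl

theorem bigVerticalLift_injective (p : TangentBundle I M) :
    Function.Injective (bigVerticalLift p) := by
  intro a b h
  refine Prod.ext (congrArg (fun c : (E × E) × (E × E →L[ℝ] ℝ) => c.1.2) h)
    (ContinuousLinearMap.ext fun v => ?_)
  exact congrArg (fun c : (E × E) × (E × E →L[ℝ] ℝ) => c.2 ((v : E), (0 : E))) h

/-- The kernel of the projection consists of the vertical lifts. -/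
theorem exists_bigVerticalLift_eq {p : TangentBundle I M} {a : BigTangent I.tangent p}
    (ha : bigProj p a = 0) : ∃ b, bigVerticalLift p b = a := by
  obtain ⟨⟨w, Z⟩, μ⟩ := a
  have h1 : w = (0 : E) := congrArg Prod.fst ha
  have h2 : ∀ v : E, μ ((0 : E), v) = 0 := fun v =>
    congrArg (fun c : E × (E →L[ℝ] ℝ) => c.2 v) ha
  refine ⟨((Z : E), (μ : E × E →L[ℝ] ℝ).comp (ContinuousLinearMap.inl ℝ E E)), ?_⟩
  refine Prod.ext (Prod.ext h1.symm rfl) (ContinuousLinearMap.ext fun v => ?_)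
  obtain ⟨v, v'⟩ := v
  change μ ((v : E), (0 : E)) = μ ((v : E), (v' : E))
  let μ' : E × E →L[ℝ] ℝ := μ
  have h3 := μ'.map_add (v, 0) (0, v')
  rw [Prod.mk_add_mk, add_zero, zero_add, show μ' (0, v') = 0 from h2 v', add_zero] at h3
  exact h3.symm

theorem IsDirac.bigProj_mem {p : TangentBundle I M} {a : BigTangent I.tangent p}
    (ha : a ∈ tangentDirac I D p) : bigProj p a ∈ D p.proj := by
  suffices h : tangentDirac I D p ≤ (D p.proj).comap (bigProj p) from h ha
  refine Submodule.span_le.2 ?_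
  rintro _ ⟨U, X, α, hU, hX, rfl | rfl⟩
  · have h : bigProj p (completeLift I X p, completeLiftForm I α p) = (X p.proj, α p.proj) := by
      refine Prod.ext rfl (ContinuousLinearMap.ext fun v => ?_)
      change formDeriv I α p.proj p.snd 0 + α p.proj v = α p.proj v
      rw [map_zero, zero_add]
    change bigProj p _ ∈ D p.proj
    rw [h]
    exact hX.mem _ hU
  · have h : bigProj p (verticalLift I X p, verticalLiftForm I α p) = 0 :=
      Prod.ext rfl (ContinuousLinearMap.ext fun v => map_zero (α p.proj))
    change bigProj p _ ∈ D p.proj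
    rw [h]
    exact zero_mem _

/-- A vertical lift belongs to the tangent Dirac structure if and only if it is the lift of an
element of the Dirac structure. -/
theorem IsDirac.bigVerticalLift_mem_iff [FiniteDimensional ℝ E] (hD : IsDirac I D)
    {p : TangentBundle I M} {a : BigTangent I p.proj} :
    bigVerticalLift p a ∈ tangentDirac I D p ↔ a ∈ D p.proj := by
  have := FiniteDimensional.complete ℝ E
  -- Every `b ∈ D_x` is the value of a section; orthogonality to its complete lift reduces to
  -- orthogonality of `a` and `b`.
  refine ⟨fun h => mem_of_orthogonal (hD.maximal_isotropic _) fun b hb => ?_, fun h => ?_⟩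
  · obtain ⟨V, Y, β, hV, hY, rfl⟩ := hD.exists_isLocalSection hb
    have h1 := tangentDirac_orthogonal_completeLift (fun x => (hD.maximal_isotropic x).1) hY hV h
    change a.2 (Y p.proj) + (formDeriv I β p.proj p.snd 0 + β p.proj a.1) = 0 at h1
    rwa [map_zero, zero_add] at h1
  · obtain ⟨U, X, α, hU, hX, rfl⟩ := hD.exists_isLocalSection h
    exact Submodule.subset_span ⟨U, X, α, hU, hX, Or.inr rfl⟩

end TangentDirac

/-- If `f` maps `S` into `A` with kernel in the image `g(K)`, then `dim S ≤ dim A + dim K`. -/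
theorem finrank_le_add_of_ker_le_map {V W W' : Type*} [AddCommGroup V] [Module ℝ V]
    [FiniteDimensional ℝ V] [AddCommGroup W] [Module ℝ W] [FiniteDimensional ℝ W]
    [AddCommGroup W'] [Module ℝ W'] [FiniteDimensional ℝ W'] {S : Submodule ℝ V}
    {A : Submodule ℝ W} {K : Submodule ℝ W'} {f : V →ₗ[ℝ] W} {g : W' →ₗ[ℝ] V}
    (hf : ∀ a ∈ S, f a ∈ A) (hg : ∀ a ∈ S, f a = 0 → ∃ b ∈ K, g b = a) :
    finrank ℝ S ≤ finrank ℝ A + finrank ℝ K := by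
  have h1 := LinearMap.finrank_range_add_finrank_ker (f.comp S.subtype)
  have h2 : finrank ℝ (LinearMap.range (f.comp S.subtype)) ≤ finrank ℝ A := by
    refine Submodule.finrank_mono ?_
    rintro _ ⟨a, rfl⟩
    exact hf a a.2
  have h3 : finrank ℝ (LinearMap.ker (f.comp S.subtype)) ≤ finrank ℝ K := by
    rw [← Submodule.finrank_map_subtype_eq S]
    refine le_trans (Submodule.finrank_mono (t := K.map g) ?_) (Submodule.finrank_map_le _ _)
    rintro _ ⟨a, ha, rfl⟩
    exact hg a a.2 ha
  omega

/-! ### The two bounds on the cosymplecticity default. -/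

section Default

variable {E : Type*} [NormedAddCommGroup E] [NormedSpace ℝ E]
  {H : Type*} [TopologicalSpace H] {I : ModelWithCorners ℝ E H}
  {M : Type*} [TopologicalSpace M] [ChartedSpace H M] [IsManifold I ∞ M]
  {D : Π x : M, Submodule ℝ (BigTangent I x)} {N : Set M}

/-- The projection of `D^tg ∩ (T H(N, D) ⊕ ann T H(N, D))` lies in `D ∩ (T N ⊕ ann H(N, D))`. -/
theorem bigProj_mem_inf_prod {p : TangentBundle I M} (hp : p ∈ naturalNormalBundle I D N)
    {a : BigTangent I.tangent p}
    (ha : a ∈ tangentDirac I D p ⊓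
      Submodule.prod (tangentOf I.tangent (naturalNormalBundle I D N) p)
        (ann I.tangent (tangentOf I.tangent (naturalNormalBundle I D N) p))) :
    bigProj p a ∈ D p.proj ⊓
      Submodule.prod (tangentOf I N p.proj) (ann I (pseudoNormal I D N p.proj)) :=
  ⟨IsDirac.bigProj_mem ha.1, fst_mem_tangentOf ha.2.1,
    fun _ hZ => ha.2.2 _ (vertical_mem_tangentOf hp hZ)⟩

variable [FiniteDimensional ℝ E]

/-- The vertical lift of `a` belongs to `D^tg ∩ (T H(N, D) ⊕ ann T H(N, D))` if and only if `a`
belongs to `D ∩ (T M ⊕ ann T N)`. -/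
theorem bigVerticalLift_mem_inf_prod_iff (hD : IsDirac I D) (hcos : IsCosymplectic I D N)
    {p : TangentBundle I M} (hp : p ∈ naturalNormalBundle I D N) {a : BigTangent I p.proj} :
    bigVerticalLift p a ∈ tangentDirac I D p ⊓
        Submodule.prod (tangentOf I.tangent (naturalNormalBundle I D N) p)
          (ann I.tangent (tangentOf I.tangent (naturalNormalBundle I D N) p)) ↔
      a ∈ D p.proj ⊓ Submodule.prod ⊤ (ann I (tangentOf I N p.proj)) := by
  constructor
  · rintro ⟨h1, -, h2⟩
    refine ⟨hD.bigVerticalLift_mem_iff.1 h1, trivial, fun v hv => ?_⟩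
    obtain ⟨w, hw, rfl⟩ := exists_mem_tangentOf_fst_eq hcos hp hv
    exact h2 w hw
  · intro h
    -- The covector part of the lift is pulled back from `M`, so on a vector tangent to `H(N, D)` it
    -- sees only the projection, which is tangent to `N`.
    have hZ : a.1 ∈ pseudoNormal I D N p.proj := ⟨a, h, rfl⟩
    refine ⟨hD.bigVerticalLift_mem_iff.2 h.1, vertical_mem_tangentOf hp hZ, fun w hw => ?_⟩
    have hann : ∀ X ∈ tangentOf I N p.proj, a.2 X = 0 := h.2.2
    have hfst := fst_mem_tangentOf hw
    exact hann _ hfst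

/-- The dimension of `D ∩ (T M ⊕ ann T N)`, the rank of `H(N, D)`, is the codimension of `N`. -/
theorem IsCosymplectic.finrank_add (hD : IsDirac I D) (hcos : IsCosymplectic I D N) {x : M}
    (hx : x ∈ N) : finrank ℝ (tangentOf I N x) +
      finrank ℝ ↥(D x ⊓ Submodule.prod ⊤ (ann I (tangentOf I N x))) = finrank ℝ E := by
  have h := hcos.isCompl x hx
  rw [(hD.maximal_isotropic x).1.finrank_inf_top_prod h rfl]
  exact Submodule.finrank_add_eq_of_isCompl h

/-- The cosymplecticity default of `H(N, D)` is at least the rank of `H(N, D)`. -/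
theorem le_cosymplecticityDefault (hD : IsDirac I D) (hcos : IsCosymplectic I D N)
    {p : TangentBundle I M} (hp : p ∈ naturalNormalBundle I D N) :
    finrank ℝ ↥(D p.proj ⊓ Submodule.prod ⊤ (ann I (tangentOf I N p.proj))) ≤
      cosymplecticityDefault I.tangent (tangentDirac I D) (naturalNormalBundle I D N) p := by
  rw [(Submodule.equivMapOfInjective _ (bigVerticalLift_injective p) _).finrank_eq]
  refine Submodule.finrank_mono ?_
  rintro _ ⟨a, ha, rfl⟩
  exact (bigVerticalLift_mem_inf_prod_iff hD hcos hp).2 ha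

/-- The cosymplecticity default of `H(N, D)` is at most the dimension of the manifold. -/
theorem cosymplecticityDefault_le (hD : IsDirac I D) (hcos : IsCosymplectic I D N)
    {p : TangentBundle I M} (hp : p ∈ naturalNormalBundle I D N) :
    cosymplecticityDefault I.tangent (tangentDirac I D) (naturalNormalBundle I D N) p ≤
      finrank ℝ E := by
  rw [← hcos.finrank_add hD hp.1]
  refine (finrank_le_add_of_ker_le_map (f := bigProj p) (g := bigVerticalLift p)
    (fun a ha => bigProj_mem_inf_prod hp ha) fun a ha ha0 => ?_).trans
    (Nat.add_le_add_right
      ((hD.maximal_isotropic p.proj).1.finrank_inf_prod_le (hcos.isCompl _ hp.1)) _)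
  obtain ⟨b, rfl⟩ := exists_bigVerticalLift_eq ha0
  exact ⟨b, (bigVerticalLift_mem_inf_prod_iff hD hcos hp).1 ha, rfl⟩

end Default

end DiracGeometry

theorem proposition4p4 {n k : ℕ} {M : Type*} [TopologicalSpace M]
    [ChartedSpace (EuclideanSpace ℝ (Fin n)) M] [IsManifold (𝓡 n) ∞ M]
    (D : ∀ x : M, Submodule ℝ (DiracGeometry.BigTangent (𝓡 n) x))
    (hD : DiracGeometry.IsDirac (𝓡 n) D)
    (N : Set M) (hN : DiracGeometry.IsEmbeddedSubmanifold (𝓡 n) N k)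
    (hcos : DiracGeometry.IsCosymplectic (𝓡 n) D N)
    (p : TangentBundle (𝓡 n) M) (hp : p ∈ DiracGeometry.naturalNormalBundle (𝓡 n) D N) :
    n - k ≤ DiracGeometry.cosymplecticityDefault (𝓡 n).tangent
        (DiracGeometry.tangentDirac (𝓡 n) D) (DiracGeometry.naturalNormalBundle (𝓡 n) D N) p ∧
      DiracGeometry.cosymplecticityDefault (𝓡 n).tangent
        (DiracGeometry.tangentDirac (𝓡 n) D) (DiracGeometry.naturalNormalBundle (𝓡 n) D N) p ≤ n :=
  by
  have h1 := hcos.finrank_add hD hp.1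
  have h2 := hN.finrank_tangentOf_le hp.1
  have h3 := DiracGeometry.le_cosymplecticityDefault hD hcos hp
  have h4 := DiracGeometry.cosymplecticityDefault_le hD hcos hp
  rw [finrank_euclideanSpace_fin] at h1 h4
  -- The inequality `dim T_xN ≤ k` suffices: it gives `n - k ≤ n - dim T_xN = dim K`.
  exact ⟨by omega, h4⟩
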